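/- Let $\Omega\subset\mathbb R^n$ be a bounded domain with Lipschitz boundary (more generally, any bounded open set), let $F\in (L^2(\Omega))^n$ and $H\in L^2(\Omega)$, and let $\varphi:\Omega\times\mathbb R^n\to\mathbb R$ be such that $\varphi(\cdot,\xi)$ is measurable for every $\xi\in\mathbb R^n$ and (C1) there is $\alpha>0$ with $0\le\varphi(x,\xi)\le\alpha|\xi|$ for all $x\in\Omega$, $\xi\in\mathbb R^n$; (C2) $\xi\mapsto\varphi(x,\xi)$ is a norm on $\mathbb R^n$ for every $x\in\Omega$. Let $\varphi^0(x,\xi)=\sup\{\xi\cdot p:\varphi(x,p)\le 1\}$ be the dual norm. Let $H^1_0(\Omega)$ be the closure of $C_c^\infty(\Omega)$ in $H^1(\Omega)$, and put $$I(u)=\int_\Omega\big(\varphi(x,Du+F)+Hu\big)\,dx,\qquad u\in H^1_0(\Omega),$$ $$E(b)=\int_\Omega\varphi(x,b+F)\,dx\ \ (b\in(L^2(\Omega))^n),\qquad G(u)=\int_\Omega Hu\,dx\ \ (u\in H^1_0(\Omega)),$$ $$\widetilde{\mathcal D}_0=\Big\{b\in (L^2(\Omega))^n:\ \int_\Omega(\nabla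 u\cdot b+Hu)\,dx=0\ \text{ for all }u\in H^1_0(\Omega)\Big\}.$$ Consider the primal problem $(P')$: $\inf_{u\in H^1_0(\Omega)} I(u)=\inf_{u\in H^1_0(\Omega)}\{E(\nabla u)+G(u)\}$, and its Rockafellar--Fenchel dual $(D')$: $\sup_{b\in(L^2(\Omega))^n}\{-E^*(b)-G^*(-\nabla^*b)\}$, where ${}^*$ on $E$ and $G$ denotes the convex conjugate and $\nabla^*$ is the adjoint of $\nabla:H^1_0(\Omega)\to(L^2(\Omega))^n$. Assume that $(P')$ is bounded below. Then the duality gap is zero, i.e. the values of $(P')$ and $(D')$ coincide, and $(D')$ has a solution: there is a maximizer $N$ of $(D')$ with $N\in\widetilde{\mathcal D}_0$ (so that $\nabla\cdot N=H$ in the sense of distributions in $\Omega$), $\varphi^0(x,N(x))\le 1$ for a.e. $x\in\Omega$, and $$\inf_{u\in H^1_0(\Omega)}\int_\Omega\big(\varphi(x,Du+F)+Hu\big)\,dx=\langle F,N\rangle=\int_\Omega F\cdot N\,dx .$$ Moreover, for this $N$ and for every minimizer $u\in H^1_0(\Omega)$ of $(P')$, $$\varphi\Big(x,\frac{Du+F}{|Du+F|}\Big)=N\cdot\frac{Du+F}{|Du+F|}\qquad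 |Du+F|\text{-a.e. in }\Omega ,$$ where $|Du+F|$ also denotes the measure with density $|Du+F|$ with respect to Lebesgue measure on $\Omega$. -/

import Mathlib

open MeasureTheory Set
open scoped ENNReal ContDiff

noncomputable section

namespace DirichletDuality

/-- The space `ℝⁿ` with its Euclidean norm and inner product. -/
abbrev Rn (n : ℕ) : Type := EuclideanSpace ℝ (Fin n)

/-- The space `L²(Ω)`. -/
abbrev L2 {n : ℕ} (Ω : Set (Rn n)) : Type := Lp ℝ 2 (volume.restrict Ω)

/-- The space `(L²(Ω))ⁿ` of square integrable vector fields. -/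
abbrev L2Vec {n : ℕ} (Ω : Set (Rn n)) : Type := Lp (Rn n) 2 (volume.restrict Ω)

/-- Test functions on `Ω`, the class `C_c^∞(Ω)`. -/
structure IsTestFunction {n : ℕ} (Ω : Set (Rn n)) (ψ : Rn n → ℝ) : Prop where
  smooth : ContDiff ℝ ∞ ψ
  compact : HasCompactSupport ψ
  support : tsupport ψ ⊆ Ω

theorem IsTestFunction.memLp {n : ℕ} {Ω : Set (Rn n)} {ψ : Rn n → ℝ}
    (hψ : IsTestFunction Ω ψ) : MemLp ψ 2 (volume.restrict Ω) :=
  (hψ.smooth.continuous.memLp_of_hasCompactSupport hψ.compact).restrict Ω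

theorem IsTestFunction.memLp_gradient {n : ℕ} {Ω : Set (Rn n)} {ψ : Rn n → ℝ}
    (hψ : IsTestFunction Ω ψ) : MemLp (gradient ψ) 2 (volume.restrict Ω) := by
  have hc : Continuous (gradient ψ) :=
    (InnerProductSpace.toDual ℝ (Rn n)).symm.continuous.comp
      (hψ.smooth.continuous_fderiv (by simp))
  have hs : HasCompactSupport (gradient ψ) :=
    (hψ.compact.fderiv ℝ).comp_left (g := (InnerProductSpace.toDual ℝ (Rn n)).symm) (map_zero _)
  exact (hc.memLp_of_hasCompactSupport hs).restrict Ω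

/-- `g` is the weak gradient of `u` on `Ω`:
`∫_Ω u ∇ψ = - ∫_Ω ψ g` (an identity of vectors) for all test functions `ψ`. -/
def IsWeakGradient {n : ℕ} (Ω : Set (Rn n)) (u : L2 Ω) (g : L2Vec Ω) : Prop :=
  ∀ ψ : Rn n → ℝ, IsTestFunction Ω ψ →
    ∫ x in Ω, u x • gradient ψ x = - ∫ x in Ω, ψ x • g x

/-- The Sobolev space `H¹(Ω)`. A function `u ∈ L²(Ω)` with weak gradient `∇u ∈ (L²(Ω))ⁿ` is
represented by the pair `(u, ∇u)`; the topology inherited from the product is that of the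
`H¹` norm. -/
def H1 {n : ℕ} (Ω : Set (Rn n)) : Submodule ℝ (L2 Ω × L2Vec Ω) where
  carrier := {w | IsWeakGradient Ω w.1 w.2}
  add_mem' := by
    intro v w hv hw ψ hψ
    have i1 (a : L2 Ω) : Integrable (fun x => a x • gradient ψ x) (volume.restrict Ω) :=
      memLp_one_iff_integrable.1 (hψ.memLp_gradient.smul (Lp.memLp a))
    have i2 (g : L2Vec Ω) : Integrable (fun x => ψ x • g x) (volume.restrict Ω) :=
      memLp_one_iff_integrable.1 ((Lp.memLp g).smul hψ.memLp)
    have e1 : ∫ x in Ω, (v + w).1 x • gradient ψ x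
        = ∫ x in Ω, (v.1 x • gradient ψ x + w.1 x • gradient ψ x) := by
      refine integral_congr_ae ?_
      filter_upwards [Lp.coeFn_add v.1 w.1] with x hx
      rw [Prod.fst_add, hx, Pi.add_apply, add_smul]
    have e2 : ∫ x in Ω, ψ x • (v + w).2 x = ∫ x in Ω, (ψ x • v.2 x + ψ x • w.2 x) := by
      refine integral_congr_ae ?_
      filter_upwards [Lp.coeFn_add v.2 w.2] with x hx
      rw [Prod.snd_add, hx, Pi.add_apply, smul_add]
    rw [e1, e2, integral_add (i1 _) (i1 _), integral_add (i2 _) (i2 _), hv ψ hψ, hw ψ hψ, neg_add]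
  zero_mem' := by
    intro ψ _
    have e1 : ∫ x in Ω, (0 : L2 Ω × L2Vec Ω).1 x • gradient ψ x = 0 := by
      refine integral_eq_zero_of_ae ?_
      filter_upwards [Lp.coeFn_zero ℝ 2 (volume.restrict Ω)] with x hx
      rw [Prod.fst_zero, hx]
      simp
    have e2 : ∫ x in Ω, ψ x • (0 : L2 Ω × L2Vec Ω).2 x = 0 := by
      refine integral_eq_zero_of_ae ?_
      filter_upwards [Lp.coeFn_zero (Rn n) 2 (volume.restrict Ω)] with x hx
      rw [Prod.snd_zero, hx]
      simp
    rw [e1, e2, neg_zero]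
  smul_mem' := by
    intro c w hw ψ hψ
    have e1 : ∫ x in Ω, (c • w).1 x • gradient ψ x
        = ∫ x in Ω, c • (w.1 x • gradient ψ x) := by
      refine integral_congr_ae ?_
      filter_upwards [Lp.coeFn_smul c w.1] with x hx
      rw [Prod.smul_fst, hx, Pi.smul_apply, smul_assoc]
    have e2 : ∫ x in Ω, ψ x • (c • w).2 x = ∫ x in Ω, c • (ψ x • w.2 x) := by
      refine integral_congr_ae ?_
      filter_upwards [Lp.coeFn_smul c w.2] with x hx
      rw [Prod.smul_snd, hx, Pi.smul_apply, smul_comm]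
    rw [e1, e2, integral_smul, integral_smul, hw ψ hψ, smul_neg]

/-- The pairs `(ψ, ∇ψ)` with `ψ ∈ C_c^∞(Ω)`. -/
def testGraph {n : ℕ} (Ω : Set (Rn n)) : Set (L2 Ω × L2Vec Ω) :=
  {w | ∃ ψ : Rn n → ℝ, IsTestFunction Ω ψ ∧
    w.1 =ᵐ[volume.restrict Ω] ψ ∧ w.2 =ᵐ[volume.restrict Ω] gradient ψ}

/-- The space `H¹₀(Ω)`: the closure of `C_c^∞(Ω)` in `H¹(Ω)`. (Test functions form a linear
subspace, so taking the span adds nothing.) -/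
def H10 {n : ℕ} (Ω : Set (Rn n)) : Submodule ℝ (L2 Ω × L2Vec Ω) :=
  H1 Ω ⊓ (Submodule.span ℝ (testGraph Ω)).topologicalClosure

/-- The function underlying an element of `H¹₀(Ω)`, as a bounded linear map. -/
def toFun {n : ℕ} (Ω : Set (Rn n)) : H10 Ω →L[ℝ] L2 Ω :=
  (ContinuousLinearMap.fst ℝ (L2 Ω) (L2Vec Ω)).comp (H10 Ω).subtypeL

/-- The gradient operator `∇ : H¹₀(Ω) → (L²(Ω))ⁿ`, as a bounded linear map. -/
def grad {n : ℕ} (Ω : Set (Rn n)) : H10 Ω →L[ℝ] L2Vec Ω :=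
  (ContinuousLinearMap.snd ℝ (L2 Ω) (L2Vec Ω)).comp (H10 Ω).subtypeL

/-- `N` is a norm on `ℝⁿ`. -/
structure IsNorm {n : ℕ} (N : Rn n → ℝ) : Prop where
  add_le : ∀ ξ η, N (ξ + η) ≤ N ξ + N η
  smul_eq : ∀ (c : ℝ) ξ, N (c • ξ) = |c| * N ξ
  eq_zero : ∀ ξ, N ξ = 0 → ξ = 0

/-- The dual norm `φ⁰(x, ξ) = sup {ξ · p : φ(x, p) ≤ 1}`. The supremum is finite whenever
`φ(x, ·)` is a norm. -/
def dualNorm {n : ℕ} (φ : Rn n → Rn n → ℝ) (x ξ : Rn n) : ℝ :=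
  sSup {t | ∃ p : Rn n, φ x p ≤ 1 ∧ t = inner ℝ ξ p}

/-- The functional `I(u) = ∫_Ω (φ(x, Du + F) + H u) dx` on `H¹₀(Ω)`, minimized in the primal
problem `(P')`. -/
def primal {n : ℕ} (Ω : Set (Rn n)) (φ : Rn n → Rn n → ℝ) (F : L2Vec Ω) (H : L2 Ω)
    (u : H10 Ω) : ℝ :=
  ∫ x in Ω, (φ x (grad Ω u x + F x) + H x * toFun Ω u x)

/-- `u` is a minimizer of the primal problem `(P')`. -/
def IsMinimizer {n : ℕ} (Ω : Set (Rn n)) (φ : Rn n → Rn n → ℝ) (F : L2Vec Ω) (H : L2 Ω)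
    (u : H10 Ω) : Prop :=
  ∀ v : H10 Ω, primal Ω φ F H u ≤ primal Ω φ F H v

/-- The functional `E(b) = ∫_Ω φ(x, b + F) dx` on `(L²(Ω))ⁿ`. -/
def funE {n : ℕ} (Ω : Set (Rn n)) (φ : Rn n → Rn n → ℝ) (F : L2Vec Ω) (b : L2Vec Ω) : ℝ :=
  ∫ x in Ω, φ x (b x + F x)

/-- The functional `G(u) = ∫_Ω H u dx` on `H¹₀(Ω)`. -/
def funG {n : ℕ} (Ω : Set (Rn n)) (H : L2 Ω) (u : H10 Ω) : ℝ :=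
  ∫ x in Ω, H x * toFun Ω u x

/-- The convex conjugate `f*(ℓ) = sup_v (ℓ(v) - f(v))` on the topological dual. -/
def conjugate {V : Type*} [NormedAddCommGroup V] [NormedSpace ℝ V] (f : V → ℝ)
    (ℓ : V →L[ℝ] ℝ) : EReal :=
  ⨆ v : V, ((ℓ v - f v : ℝ) : EReal)

/-- The functional on `(L²(Ω))ⁿ` represented by `b`. -/
def riesz {n : ℕ} (Ω : Set (Rn n)) (b : L2Vec Ω) : L2Vec Ω →L[ℝ] ℝ := innerSL ℝ b

/-- The functional `-E*(b) - G*(-∇*b)` maximized over `b ∈ (L²(Ω))ⁿ` in the dual problem `(D')`.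
Here `(L²(Ω))ⁿ` is identified with its dual, and `∇*b` is the functional `u ↦ ⟨b, ∇u⟩`. -/
def dual {n : ℕ} (Ω : Set (Rn n)) (φ : Rn n → Rn n → ℝ) (F : L2Vec Ω) (H : L2 Ω)
    (b : L2Vec Ω) : EReal :=
  - conjugate (funE Ω φ F) (riesz Ω b)
    - conjugate (funG Ω H) (-((riesz Ω b).comp (grad Ω)))

/-- The set of all `b ∈ (L²(Ω))ⁿ` with `∫_Ω (∇u · b + H u) dx = 0` for all `u ∈ H¹₀(Ω)`. -/
def D0 {n : ℕ} (Ω : Set (Rn n)) (H : L2 Ω) : Set (L2Vec Ω) :=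
  {b | ∀ u : H10 Ω, ∫ x in Ω, (inner ℝ (grad Ω u x) (b x) + H x * toFun Ω u x) = 0}

/-- `∇ · b = h` in the sense of distributions on `Ω`. -/
def HasWeakDivergence {n : ℕ} (Ω : Set (Rn n)) (b : L2Vec Ω) (h : L2 Ω) : Prop :=
  ∀ ψ : Rn n → ℝ, IsTestFunction Ω ψ →
    ∫ x in Ω, inner ℝ (b x) (gradient ψ x) = - ∫ x in Ω, h x * ψ x

end DirichletDuality

end

open DirichletDuality

/-!
The integral functional `Φ(b) = ∫_Ω φ(x, b) dx` is sublinear on `(L²(Ω))ⁿ` and bounded by a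
multiple of the norm, and the primal functional is `Φ(∇u + F) + G(u)` with `G` linear. The proof
applies the Hahn-Banach theorem to the value function `p(b) = inf_u (Φ(∇u + b) + G(u))`.
It is sublinear, and boundedness below at `b = F` makes it finite everywhere, so some linear
functional `ℓ ≤ p` satisfies `ℓ(F) = p(F) = inf I`.
* Since `ℓ ≤ p ≤ Φ`, the functional is bounded, hence `ℓ = ⟨N, ·⟩` with `N ∈ (L²(Ω))ⁿ`.
* Since `p(-∇u) ≤ Φ(0) + G(u) = G(u)` and both sides of `-ℓ(∇u) ≤ G(u)` are linear in `u`, equality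
  holds, which says that `N` belongs to `D0 Ω H`. See `exists_linearMap_isGLB_of_sublinear`
  for these two points in abstract form and `IsNormIntegrand.exists_mem_D0_isGLB` for the result.
* The inequality `⟨N, b⟩ ≤ Φ(b)` localizes to `N(x) · ξ ≤ φ(x, ξ)` for almost every `x` and all `ξ`
  (`IsNormIntegrand.ae_inner_le`), which is the bound on the dual norm.

Weak duality (`dual_le_coe`) bounds the dual values by `inf I = ⟨N, F⟩`, and the properties of `N`
give `⟨N, F⟩ ≤ -E*(N) - G*(-∇*N)` (`coe_le_dual`), so that there is no gap and `N` is optimal. At a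
minimizer `u` the nonnegative function `φ(x, Du + F) - N · (Du + F)` has integral
`I(u) - ⟨F, N⟩ = 0`, hence it vanishes almost everywhere.
-/

open DirichletDuality

namespace DirichletDuality

/-! ### Sublinear duality -/

/-- A real-valued sublinear functional has a linear minorant touching it at a given point. -/
theorem exists_linearMap_le_sublinear_eq {E : Type*} [AddCommGroup E] [Module ℝ E] (p : E → ℝ)
    (hom : ∀ c : ℝ, 0 < c → ∀ x, p (c • x) = c * p x) (add : ∀ x y, p (x + y) ≤ p x + p y)
    (x₀ : E) : ∃ g : E →ₗ[ℝ] ℝ, g x₀ = p x₀ ∧ ∀ x, g x ≤ p x := by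
  have h0 : p 0 = 0 := by
    have := hom 2 two_pos 0
    rw [smul_zero] at this
    linarith
  have hx : ∀ c : ℝ, c • x₀ = 0 → c • p x₀ = 0 := by
    intro c hc
    rcases smul_eq_zero.1 hc with h | h
    · simp [h]
    · simp [h, h0]
  have hle : ∀ c : ℝ, c * p x₀ ≤ p (c • x₀) := by
    intro c
    rcases lt_trichotomy c 0 with hc | hc | hc
    · have h1 := add (c • x₀) ((-c) • x₀)
      rw [← add_smul, add_neg_cancel, zero_smul, h0, hom (-c) (neg_pos.2 hc)] at h1
      linarith
    · simp [hc, h0]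
    · exact (hom c hc x₀).ge
  obtain ⟨g, hg, hgp⟩ := exists_extension_of_le_sublinear
    (LinearPMap.mkSpanSingleton' x₀ (p x₀) hx) p hom add (by
      rintro ⟨x, hx'⟩
      obtain ⟨c, rfl⟩ := Submodule.mem_span_singleton.1 hx'
      rw [LinearPMap.mkSpanSingleton'_apply]
      exact hle c)
  refine ⟨g, ?_, hgp⟩
  exact (hg ⟨x₀, Submodule.mem_span_singleton_self x₀⟩).trans
    (LinearPMap.mkSpanSingleton'_apply_self ..)

/-- Fenchel duality for `Φ(Au + F) + G(u)` with `Φ` sublinear and `G` linear: `ℓ` is a linear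
minorant of the value function `x ↦ inf_u (Φ(Au + x) + G(u))` touching it at `F`. No continuity is
needed, because the value function is finite on the whole space. -/
theorem exists_linearMap_isGLB_of_sublinear {V X : Type*} [AddCommGroup V] [Module ℝ V]
    [AddCommGroup X] [Module ℝ X] (A : V →ₗ[ℝ] X) (G : V →ₗ[ℝ] ℝ) (Φ : X → ℝ)
    (hom : ∀ c : ℝ, 0 < c → ∀ x, Φ (c • x) = c * Φ x) (add : ∀ x y, Φ (x + y) ≤ Φ x + Φ y)
    (F : X) (hb : BddBelow (range fun u => Φ (A u + F) + G u)) :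
    ∃ ℓ : X →ₗ[ℝ] ℝ, (∀ x, ℓ x ≤ Φ x) ∧ (∀ u, ℓ (A u) + G u = 0) ∧
      IsGLB (range fun u => Φ (A u + F) + G u) (ℓ F) := by
  have h0 : Φ 0 = 0 := by
    have := hom 2 two_pos 0
    rw [smul_zero] at this
    linarith
  -- Finiteness of the value function at `F` propagates to every point by subadditivity.
  have hbdd : ∀ x, BddBelow (range fun u => Φ (A u + x) + G u) := by
    obtain ⟨m, hm⟩ := hb
    intro x
    refine ⟨m - Φ (F - x), ?_⟩
    rintro _ ⟨u, rfl⟩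
    have h1 : m ≤ Φ (A u + F) + G u := hm ⟨u, rfl⟩
    have h2 := add (A u + x) (F - x)
    rw [show A u + x + (F - x) = A u + F by abel] at h2
    simp only
    linarith
  set p : X → ℝ := fun x => ⨅ u, (Φ (A u + x) + G u)
  have ple : ∀ x u, p x ≤ Φ (A u + x) + G u := fun x u => ciInf_le (hbdd x) u
  have phom : ∀ c : ℝ, 0 < c → ∀ x, p (c • x) = c * p x := by
    have key : ∀ c : ℝ, 0 < c → ∀ x, p (c • x) ≤ c * p x := by
      intro c hc x
      rw [← div_le_iff₀' hc]
      refine le_ciInf fun u => ?_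
      rw [div_le_iff₀' hc]
      have := ple (c • x) (c • u)
      rwa [map_smul, map_smul, ← smul_add, hom c hc, smul_eq_mul, ← mul_add] at this
    intro c hc x
    refine le_antisymm (key c hc x) ?_
    have := key c⁻¹ (inv_pos.2 hc) (c • x)
    rwa [inv_smul_smul₀ hc.ne', inv_mul_eq_div, le_div_iff₀' hc] at this
  have padd : ∀ x y, p (x + y) ≤ p x + p y := by
    intro x y
    refine le_ciInf_add_ciInf fun u v => ?_
    have h1 := ple (x + y) (u + v)
    have h2 := add (A u + x) (A v + y)
    rw [map_add, map_add, show A u + A v + (x + y) = A u + x + (A v + y) by abel] at h1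
    linarith
  obtain ⟨ℓ, hℓF, hℓ⟩ := exists_linearMap_le_sublinear_eq p phom padd F
  have hle : ∀ u, 0 ≤ ℓ (A u) + G u := by
    intro u
    have h1 := (hℓ (-(A u))).trans (ple (-(A u)) u)
    rw [add_neg_cancel, h0, map_neg] at h1
    linarith
  refine ⟨ℓ, fun x => ?_, fun u => ?_, ?_⟩
  · simpa using (hℓ x).trans (ple x 0)
  · have h1 := hle (-u)
    rw [map_neg, map_neg, map_neg] at h1
    linarith [hle u]
  · rw [hℓF]
    exact isGLB_ciInf (hbdd F)

/-! ### Integrands that are norms in the second variable -/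

/-- Superposition with a Carathéodory function preserves measurability, by approximation of `g` with
simple functions. -/
theorem aestronglyMeasurable_comp_of_continuous {X E : Type*} [MeasurableSpace X]
    {μ : Measure X} [TopologicalSpace E] {f : X → E → ℝ}
    (hf : ∀ ξ, AEStronglyMeasurable (fun x => f x ξ) μ) (hc : ∀ᵐ x ∂μ, Continuous (f x))
    {g : X → E} (hg : AEStronglyMeasurable g μ) :
    AEStronglyMeasurable (fun x => f x (g x)) μ := by
  obtain ⟨g', hg', hgg'⟩ := hg
  have h1 : ∀ s : SimpleFunc X E, AEStronglyMeasurable (fun x => f x (s x)) μ := by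
    intro s
    have e : (fun x => f x (s x))
        = fun x => ∑ y ∈ s.range, (s ⁻¹' {y}).indicator (fun x => f x y) x := by
      funext x
      rw [Finset.sum_eq_single (s x)]
      · simp
      · intro y _ hy
        exact indicator_of_notMem (fun h => hy (by simpa using h.symm)) _
      · exact fun h => (h (s.mem_range_self x)).elim
    rw [e]
    exact Finset.aestronglyMeasurable_fun_sum _ fun y _ =>
      (hf y).indicator (s.measurableSet_preimage _)
  have h2 : AEStronglyMeasurable (fun x => f x (g' x)) μ := by
    refine aestronglyMeasurable_of_tendsto_ae Filter.atTop (fun k => h1 (hg'.approx k)) ?_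
    filter_upwards [hc] with x hx
    exact (hx.tendsto _).comp (hg'.tendsto_approx x)
  refine h2.congr ?_
  filter_upwards [hgg'] with x hx
  rw [hx]

/-- A Carathéodory integrand on a measure space over `ℝⁿ` that is almost everywhere a norm in the
second variable, bounded by `α` times the Euclidean norm. -/
structure IsNormIntegrand {n : ℕ} (μ : Measure (Rn n)) (φ : Rn n → Rn n → ℝ) (α : ℝ) : Prop where
  aesm : ∀ ξ, AEStronglyMeasurable (fun x => φ x ξ) μ
  bound : ∀ᵐ x ∂μ, ∀ ξ, 0 ≤ φ x ξ ∧ φ x ξ ≤ α * ‖ξ‖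
  isNorm : ∀ᵐ x ∂μ, IsNorm (φ x)

theorem IsNorm.map_zero {n : ℕ} {N : Rn n → ℝ} (hN : IsNorm N) : N 0 = 0 := by
  simpa using hN.smul_eq 0 0

theorem IsNorm.continuous {n : ℕ} {N : Rn n → ℝ} (hN : IsNorm N) {α : ℝ}
    (hα : ∀ ξ, N ξ ≤ α * ‖ξ‖) : Continuous N := by
  have h : ∀ ξ η, N ξ - N η ≤ α * ‖ξ - η‖ := fun ξ η => by
    have := hN.add_le (ξ - η) η
    rw [sub_add_cancel] at this
    linarith [hα (ξ - η)]
  refine (LipschitzWith.of_le_add_mul α.toNNReal fun ξ η => ?_).continuous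
  have h1 : α * ‖ξ - η‖ ≤ α.toNNReal * ‖ξ - η‖ :=
    mul_le_mul_of_nonneg_right (Real.le_coe_toNNReal α) (norm_nonneg _)
  rw [dist_eq_norm]
  linarith [h ξ η]

namespace IsNormIntegrand

variable {n : ℕ} {μ : Measure (Rn n)} {φ : Rn n → Rn n → ℝ} {α : ℝ}

theorem ae_continuous (h : IsNormIntegrand μ φ α) : ∀ᵐ x ∂μ, Continuous (φ x) := by
  filter_upwards [h.bound, h.isNorm] with x hb hn
  exact hn.continuous fun ξ => (hb ξ).2

theorem integrable (h : IsNormIntegrand μ φ α) {b : Rn n → Rn n} (hb : Integrable b μ) :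
    Integrable (fun x => φ x (b x)) μ := by
  refine (hb.norm.const_mul α).mono'
    (aestronglyMeasurable_comp_of_continuous h.aesm h.ae_continuous hb.1) ?_
  filter_upwards [h.bound] with x hx
  rw [Real.norm_of_nonneg (hx _).1]
  exact (hx _).2

/-- If a vector field lies below the integral functional `b ↦ ∫ φ(x, b)` on `L²`, then it lies
below `φ` pointwise: test with indicator functions times vectors of a countable dense set. -/
theorem ae_inner_le [IsFiniteMeasure μ] (h : IsNormIntegrand μ φ α) (N : Lp (Rn n) 2 μ)
    (hN : ∀ b : Lp (Rn n) 2 μ, inner ℝ N b ≤ ∫ x, φ x (b x) ∂μ) :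
    ∀ᵐ x ∂μ, ∀ ξ, inner ℝ (N x) ξ ≤ φ x ξ := by
  have hNi : Integrable N μ := (Lp.memLp N).integrable one_le_two
  have h1 : ∀ ξ : Rn n, ∀ᵐ x ∂μ, inner ℝ (N x) ξ ≤ φ x ξ := by
    intro ξ
    refine ae_le_of_forall_setIntegral_le (hNi.inner_const ξ)
      (h.integrable (integrable_const ξ)) fun s hs hμs => ?_
    have h2 := hN (indicatorConstLp 2 hs hμs.ne ξ)
    rw [real_inner_comm, L2.inner_indicatorConstLp_eq_setIntegral_inner ℝ N hs ξ hμs.ne] at h2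
    refine (integral_congr_ae (.of_forall fun x => real_inner_comm _ _)).trans_le
      (h2.trans_eq ?_)
    rw [← integral_indicator hs]
    refine integral_congr_ae ?_
    filter_upwards [indicatorConstLp_coeFn (p := 2) (hs := hs) (hμs := hμs.ne) (c := ξ), h.isNorm]
      with x hx hn
    rw [hx]
    by_cases hxs : x ∈ s
    · simp [hxs]
    · simp [hxs, hn.map_zero]
  have h3 := ae_all_iff.2 fun k => h1 (TopologicalSpace.denseSeq (Rn n) k)
  filter_upwards [h3, h.ae_continuous] with x hx hc ξ
  refine (TopologicalSpace.denseRange_denseSeq (Rn n)).induction_on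
    (p := fun ξ => inner ℝ (N x) ξ ≤ φ x ξ) ξ
    (isClosed_le (by fun_prop) hc) hx

end IsNormIntegrand

theorem integral_norm_le_mul_norm {n : ℕ} {μ : Measure (Rn n)} [IsFiniteMeasure μ]
    (b : Lp (Rn n) 2 μ) : ∫ x, ‖b x‖ ∂μ ≤ μ.real univ ^ (1 / 2 : ℝ) * ‖b‖ := by
  have h := eLpNorm_le_eLpNorm_mul_rpow_measure_univ (one_le_two (α := ℝ≥0∞))
    (Lp.aestronglyMeasurable b)
  have h2 := ENNReal.toReal_mono (ENNReal.mul_ne_top (Lp.eLpNorm_ne_top b)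
    (ENNReal.rpow_ne_top_of_nonneg (by norm_num) (measure_ne_top μ _))) h
  rw [ENNReal.toReal_mul, ← Lp.norm_def, ← ENNReal.toReal_rpow, mul_comm] at h2
  have e : ∫ x, ‖b x‖ ∂μ = (eLpNorm b 1 μ).toReal := by
    rw [integral_norm_eq_lintegral_enorm (Lp.aestronglyMeasurable b),
      eLpNorm_one_eq_lintegral_enorm]
  rw [e]
  have hexp : (1 / 2 : ℝ) = 1 / ENNReal.toReal 1 - 1 / ENNReal.toReal 2 := by
    rw [ENNReal.toReal_one, ENNReal.toReal_ofNat]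
    norm_num
  rwa [hexp, Measure.real]

/-! ### Test functions -/

section TestFunctions

variable {n : ℕ} {Ω : Set (Rn n)}

theorem IsTestFunction.integrable_smul_gradient {ψ η : Rn n → ℝ}
    (hψ : IsTestFunction Ω ψ) (hη : IsTestFunction Ω η) :
    Integrable (fun x => ψ x • gradient η x) (volume.restrict Ω) :=
  memLp_one_iff_integrable.1 (hη.memLp_gradient.smul hψ.memLp)

theorem IsTestFunction.integral_smul_gradient {ψ η : Rn n → ℝ}
    (hψ : IsTestFunction Ω ψ) (hη : IsTestFunction Ω η) :
    ∫ x in Ω, ψ x • gradient η x = - ∫ x in Ω, η x • gradient ψ x := by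
  have hz : ∀ {ψ : Rn n → ℝ}, IsTestFunction Ω ψ → ∀ x ∉ Ω, ψ x = 0 := fun hψ x hx =>
    image_eq_zero_of_notMem_tsupport fun h => hx (hψ.support h)
  have he : ∀ {ψ η : Rn n → ℝ}, IsTestFunction Ω ψ → IsTestFunction Ω η → ∀ v,
      inner ℝ (∫ x in Ω, ψ x • gradient η x) v = ∫ x, ψ x * fderiv ℝ η x v := by
    intro ψ η hψ hη v
    rw [real_inner_comm, ← integral_inner (hψ.integrable_smul_gradient hη),
      setIntegral_eq_integral_of_forall_compl_eq_zero fun x hx => by simp [hz hψ x hx]]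
    refine integral_congr_ae (.of_forall fun x => ?_)
    simp only [inner_smul_right, inner_gradient_right, conj_trivial]
  refine ext_inner_right ℝ fun v => ?_
  rw [inner_neg_left, he hψ hη, he hη hψ]
  have cf : ∀ {ψ : Rn n → ℝ}, IsTestFunction Ω ψ → Continuous fun x => fderiv ℝ ψ x v :=
    fun hψ => (hψ.smooth.continuous_fderiv (by simp)).clm_apply continuous_const
  have h := integral_mul_fderiv_eq_neg_fderiv_mul_of_integrable (μ := volume) (v := v)
    (f := ψ) (g := η)
    (((cf hψ).mul hη.smooth.continuous).integrable_of_hasCompactSupport hη.compact.mul_left)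
    ((hψ.smooth.continuous.mul (cf hη)).integrable_of_hasCompactSupport hψ.compact.mul_right)
    ((hψ.smooth.continuous.mul hη.smooth.continuous).integrable_of_hasCompactSupport
      hψ.compact.mul_right)
    (fun x _ => hψ.smooth.differentiable (by simp) x)
    (fun x _ => hη.smooth.differentiable (by simp) x)
  rw [h]
  simp_rw [mul_comm]

/-- The classical gradient of a test function is its weak gradient, by integration by parts. -/
theorem IsTestFunction.mem_H10 {ψ : Rn n → ℝ} (hψ : IsTestFunction Ω ψ) :
    (hψ.memLp.toLp ψ, hψ.memLp_gradient.toLp (gradient ψ)) ∈ H10 Ω := by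
  refine ⟨fun η hη => ?_, Submodule.le_topologicalClosure _ (Submodule.subset_span
    ⟨ψ, hψ, hψ.memLp.coeFn_toLp, hψ.memLp_gradient.coeFn_toLp⟩)⟩
  have e1 : ∫ x in Ω, hψ.memLp.toLp ψ x • gradient η x = ∫ x in Ω, ψ x • gradient η x := by
    refine integral_congr_ae ?_
    filter_upwards [hψ.memLp.coeFn_toLp] with x hx
    rw [hx]
  have e2 : ∫ x in Ω, η x • hψ.memLp_gradient.toLp (gradient ψ) x
      = ∫ x in Ω, η x • gradient ψ x := by
    refine integral_congr_ae ?_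
    filter_upwards [hψ.memLp_gradient.coeFn_toLp] with x hx
    rw [hx]
  rw [e1, e2, hψ.integral_smul_gradient hη]

theorem integrable_inner_L2Vec (a b : L2Vec Ω) :
    Integrable (fun x => inner ℝ (a x) (b x)) (volume.restrict Ω) :=
  L2.integrable_inner a b

theorem integrable_mul_L2 (a b : L2 Ω) :
    Integrable (fun x => a x * b x) (volume.restrict Ω) :=
  (Lp.memLp a).integrable_mul (Lp.memLp b)

theorem funG_eq_inner (H : L2 Ω) (u : H10 Ω) : funG Ω H u = inner ℝ (toFun Ω u) H := by
  rw [L2.inner_def]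
  rfl

theorem mem_D0_iff {H : L2 Ω} {b : L2Vec Ω} :
    b ∈ D0 Ω H ↔ ∀ u : H10 Ω, inner ℝ b (grad Ω u) + funG Ω H u = 0 := by
  refine forall_congr' fun u => ?_
  rw [integral_add (integrable_inner_L2Vec _ _) (integrable_mul_L2 _ _), real_inner_comm,
    L2.inner_def]
  rfl

theorem hasWeakDivergence_of_mem_D0 {H : L2 Ω} {b : L2Vec Ω} (hb : b ∈ D0 Ω H) :
    HasWeakDivergence Ω b H := by
  intro ψ hψ
  have h := hb ⟨_, hψ.mem_H10⟩
  rw [integral_add (integrable_inner_L2Vec _ _) (integrable_mul_L2 _ _)] at h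
  have e1 : ∫ x in Ω, inner ℝ (grad Ω ⟨_, hψ.mem_H10⟩ x) (b x)
      = ∫ x in Ω, inner ℝ (b x) (gradient ψ x) := by
    refine integral_congr_ae ?_
    filter_upwards [hψ.memLp_gradient.coeFn_toLp] with x hx
    rw [real_inner_comm, ← hx]
    rfl
  have e2 : ∫ x in Ω, H x * toFun Ω ⟨_, hψ.mem_H10⟩ x = ∫ x in Ω, H x * ψ x := by
    refine integral_congr_ae ?_
    filter_upwards [hψ.memLp.coeFn_toLp] with x hx
    rw [← hx]
    rfl
  rw [e1, e2] at h
  linarith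

end TestFunctions

/-! ### The primal and dual problems -/

section Duality

variable {n : ℕ} {Ω : Set (Rn n)} {φ : Rn n → Rn n → ℝ} {F : L2Vec Ω} {H : L2 Ω}

/-- Weak duality. -/
theorem dual_le_coe (b : L2Vec Ω) (u : H10 Ω) :
    dual Ω φ F H b ≤ ((funE Ω φ F (grad Ω u) + funG Ω H u : ℝ) : EReal) := by
  have h1 : -conjugate (funE Ω φ F) (riesz Ω b)
      ≤ ((funE Ω φ F (grad Ω u) - riesz Ω b (grad Ω u) : ℝ) : EReal) := by
    rw [EReal.neg_le, ← EReal.coe_neg, neg_sub]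
    exact le_iSup (fun v => ((riesz Ω b v - funE Ω φ F v : ℝ) : EReal)) (grad Ω u)
  have h2 : -conjugate (funG Ω H) (-((riesz Ω b).comp (grad Ω)))
      ≤ ((riesz Ω b (grad Ω u) + funG Ω H u : ℝ) : EReal) := by
    rw [EReal.neg_le, ← EReal.coe_neg]
    refine le_trans (le_of_eq ?_)
      (le_iSup (fun v => (((-((riesz Ω b).comp (grad Ω))) v - funG Ω H v : ℝ) : EReal)) u)
    congr 1
    simp
    ring
  rw [dual, sub_eq_add_neg]
  refine (add_le_add h1 h2).trans_eq ?_
  rw [← EReal.coe_add]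
  congr 1
  ring

/-- The hypothesis `hE` says `E*(N) ≤ -⟨N, F⟩`, and `N ∈ D0 Ω H` says `G*(-∇*N) = 0`. -/
theorem coe_le_dual {N : L2Vec Ω} (hN : N ∈ D0 Ω H)
    (hE : ∀ v : L2Vec Ω, inner ℝ N (v + F) ≤ funE Ω φ F v) :
    ((inner ℝ N F : ℝ) : EReal) ≤ dual Ω φ F H N := by
  have h1 : ((inner ℝ N F : ℝ) : EReal) ≤ -conjugate (funE Ω φ F) (riesz Ω N) := by
    rw [EReal.le_neg, ← EReal.coe_neg]
    refine iSup_le fun v => EReal.coe_le_coe_iff.2 ?_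
    have := hE v
    rw [inner_add_right] at this
    change inner ℝ N v - _ ≤ _
    linarith
  have h2 : (0 : EReal) ≤ -conjugate (funG Ω H) (-((riesz Ω N).comp (grad Ω))) := by
    rw [EReal.le_neg, neg_zero, ← EReal.coe_zero]
    refine iSup_le fun u => EReal.coe_le_coe_iff.2 ?_
    have := mem_D0_iff.1 hN u
    change -inner ℝ N (grad Ω u) - _ ≤ _
    linarith
  rw [dual, sub_eq_add_neg]
  simpa using add_le_add h1 h2

theorem iInf_coe_eq_of_isGLB {ι : Type*} {f : ι → ℝ} {m : ℝ} (h : IsGLB (range f) m) :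
    (⨅ i, (f i : EReal)) = m := by
  refine le_antisymm ?_ (le_iInf fun i => EReal.coe_le_coe_iff.2 (h.1 ⟨i, rfl⟩))
  refine EReal.le_of_forall_lt_iff_le.1 fun z hz => ?_
  obtain ⟨_, ⟨i, rfl⟩, hi⟩ := (isGLB_lt_iff h).1 (EReal.coe_lt_coe_iff.1 hz)
  exact (iInf_le _ i).trans (EReal.coe_le_coe_iff.2 hi.le)

theorem funE_eq_integral (b : L2Vec Ω) :
    funE Ω φ F b = ∫ x in Ω, φ x ((b + F : L2Vec Ω) x) := by
  refine integral_congr_ae ?_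
  filter_upwards [Lp.coeFn_add b F] with x hx
  rw [hx, Pi.add_apply]

variable {α : ℝ} [IsFiniteMeasure (volume.restrict Ω)]

theorem IsNormIntegrand.integrable_L2Vec (h : IsNormIntegrand (volume.restrict Ω) φ α)
    (b : L2Vec Ω) : Integrable (fun x => φ x (b x)) (volume.restrict Ω) :=
  h.integrable ((Lp.memLp b).integrable one_le_two)

theorem IsNormIntegrand.integrable_add (h : IsNormIntegrand (volume.restrict Ω) φ α)
    (a b : L2Vec Ω) : Integrable (fun x => φ x (a x + b x)) (volume.restrict Ω) :=
  h.integrable (((Lp.memLp a).add (Lp.memLp b)).integrable one_le_two)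

theorem IsNormIntegrand.primal_eq (h : IsNormIntegrand (volume.restrict Ω) φ α) (u : H10 Ω) :
    primal Ω φ F H u = funE Ω φ F (grad Ω u) + funG Ω H u :=
  integral_add (h.integrable_add _ _) (integrable_mul_L2 _ _)

/-- Existence of the dual optimizer, as the Riesz representative of the Hahn-Banach functional. -/
theorem IsNormIntegrand.exists_mem_D0_isGLB (h : IsNormIntegrand (volume.restrict Ω) φ α)
    (hα : 0 ≤ α) (hP : BddBelow (range (primal Ω φ F H))) :
    ∃ N : L2Vec Ω, N ∈ D0 Ω H ∧ (∀ b : L2Vec Ω, inner ℝ N b ≤ ∫ x in Ω, φ x (b x)) ∧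
      IsGLB (range (primal Ω φ F H)) (inner ℝ N F) := by
  set Φ : L2Vec Ω → ℝ := fun b => ∫ x in Ω, φ x (b x) with hΦ
  have hom : ∀ c : ℝ, 0 < c → ∀ b, Φ (c • b) = c * Φ b := by
    intro c hc b
    rw [hΦ]
    simp only
    rw [← integral_const_mul]
    refine integral_congr_ae ?_
    filter_upwards [Lp.coeFn_smul c b, h.isNorm] with x hx hn
    rw [hx, Pi.smul_apply, hn.smul_eq, abs_of_pos hc]
  have add : ∀ a b, Φ (a + b) ≤ Φ a + Φ b := by
    intro a b
    rw [hΦ]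
    simp only
    rw [← integral_add (h.integrable_L2Vec a) (h.integrable_L2Vec b)]
    refine integral_mono_ae (h.integrable_L2Vec _)
      ((h.integrable_L2Vec a).add (h.integrable_L2Vec b)) ?_
    filter_upwards [Lp.coeFn_add a b, h.isNorm] with x hx hn
    rw [hx]
    exact hn.add_le _ _
  have hle : ∀ b, Φ b ≤ α * (volume.restrict Ω).real univ ^ (1 / 2 : ℝ) * ‖b‖ := by
    intro b
    rw [mul_assoc]
    refine le_trans ?_ (mul_le_mul_of_nonneg_left (integral_norm_le_mul_norm b) hα)
    rw [← integral_const_mul]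
    refine integral_mono_ae (h.integrable_L2Vec b)
      (((Lp.memLp b).integrable one_le_two).norm.const_mul α) ?_
    filter_upwards [h.bound] with x hx
    exact (hx _).2
  set G : H10 Ω →ₗ[ℝ] ℝ := ((innerSL ℝ H).comp (toFun Ω)).toLinearMap
  have hGu : ∀ u, G u = funG Ω H u := fun u => by
    rw [funG_eq_inner, real_inner_comm]
    rfl
  have hp : primal Ω φ F H = fun u => Φ ((grad Ω).toLinearMap u + F) + G u := by
    funext u
    rw [h.primal_eq, funE_eq_integral, hGu]
    rfl
  rw [hp] at hP ⊢
  obtain ⟨ℓ, hℓ, hA, hglb⟩ :=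
    exists_linearMap_isGLB_of_sublinear (grad Ω).toLinearMap G Φ hom add F hP
  let L : L2Vec Ω →L[ℝ] ℝ := ℓ.mkContinuous _ fun b => by
    rw [Real.norm_eq_abs]
    refine abs_le'.2 ⟨(hℓ b).trans (hle b), ?_⟩
    rw [← map_neg, ← norm_neg b]
    exact (hℓ _).trans (hle _)
  have hN : ∀ b, inner ℝ ((InnerProductSpace.toDual ℝ (L2Vec Ω)).symm L) b = ℓ b := fun b =>
    InnerProductSpace.toDual_symm_apply
  refine ⟨(InnerProductSpace.toDual ℝ (L2Vec Ω)).symm L, mem_D0_iff.2 fun u => ?_,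
    fun b => ?_, ?_⟩
  · rw [hN, ← hGu]
    exact hA u
  · rw [hN]
    exact hℓ b
  · rwa [hN]

/-- Equality `φ(x, Du + F) = N · (Du + F)` at a minimizer: the nonnegative difference has integral
`I(u) - ⟨F, N⟩ = 0`. -/
theorem IsNormIntegrand.ae_eq_inner (h : IsNormIntegrand (volume.restrict Ω) φ α)
    {N : L2Vec Ω} (hN : N ∈ D0 Ω H) (hle : ∀ᵐ x ∂(volume.restrict Ω), ∀ ξ, inner ℝ (N x) ξ ≤ φ x ξ)
    {u : H10 Ω} (hu : primal Ω φ F H u = inner ℝ N F) :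
    ∀ᵐ x ∂(volume.restrict Ω),
      φ x (grad Ω u x + F x) = inner ℝ (N x) (grad Ω u x + F x) := by
  have i1 := h.integrable_add (grad Ω u) F
  have i2 : Integrable (fun x => inner ℝ (N x) (grad Ω u x + F x)) (volume.restrict Ω) := by
    simp_rw [inner_add_right]
    exact (integrable_inner_L2Vec _ _).add (integrable_inner_L2Vec _ _)
  have e : ∫ x in Ω, inner ℝ (N x) (grad Ω u x + F x) = inner ℝ N (grad Ω u) + inner ℝ N F := by
    simp_rw [inner_add_right]
    rw [integral_add (integrable_inner_L2Vec _ _) (integrable_inner_L2Vec _ _), L2.inner_def,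
      L2.inner_def]
  have h0 : ∫ x in Ω, (φ x (grad Ω u x + F x) - inner ℝ (N x) (grad Ω u x + F x)) = 0 := by
    rw [integral_sub i1 i2, e]
    have h1 := h.primal_eq (F := F) (H := H) u
    have h2 := mem_D0_iff.1 hN u
    rw [funE] at h1
    linarith
  rw [integral_eq_zero_iff_of_nonneg_ae (μ := volume.restrict Ω)
    (f := fun x => φ x (grad Ω u x + F x) - inner ℝ (N x) (grad Ω u x + F x)) (by
    filter_upwards [hle] with x hx using sub_nonneg.2 (hx _)) (i1.sub i2)] at h0
  filter_upwards [h0] with x hx using sub_eq_zero.1 hx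

end Duality

theorem dualNorm_le_one {n : ℕ} {φ : Rn n → Rn n → ℝ} {x ν : Rn n}
    (h : ∀ ξ, inner ℝ ν ξ ≤ φ x ξ) : dualNorm φ x ν ≤ 1 := by
  refine Real.sSup_le ?_ zero_le_one
  rintro _ ⟨p, hp, rfl⟩
  exact (h p).trans hp

end DirichletDuality

theorem mainTheorem3 (n : ℕ) (Ω : Set (Rn n)) (hΩo : IsOpen Ω) (hΩb : Bornology.IsBounded Ω)
    (F : L2Vec Ω) (H : L2 Ω) (φ : Rn n → Rn n → ℝ)
    (hφm : ∀ ξ : Rn n, AEStronglyMeasurable (fun x => φ x ξ) (volume.restrict Ω))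
    (hC1 : ∃ α : ℝ, 0 < α ∧ ∀ x ∈ Ω, ∀ ξ : Rn n, 0 ≤ φ x ξ ∧ φ x ξ ≤ α * ‖ξ‖)
    (hC2 : ∀ x ∈ Ω, IsNorm (φ x))
    (hP : BddBelow (Set.range (primal Ω φ F H))) :
    -- the duality gap is zero
    (⨅ u : H10 Ω, (primal Ω φ F H u : EReal)) = (⨆ b : L2Vec Ω, dual Ω φ F H b) ∧
    ∃ N : L2Vec Ω,
      -- `N` solves the dual problem
      (∀ b : L2Vec Ω, dual Ω φ F H b ≤ dual Ω φ F H N) ∧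
      N ∈ D0 Ω H ∧
      HasWeakDivergence Ω N H ∧
      (∀ᵐ x ∂(volume.restrict Ω), dualNorm φ x (N x) ≤ 1) ∧
      -- the infimum of the primal problem equals `⟨F, N⟩`
      IsGLB (Set.range (primal Ω φ F H)) (∫ x in Ω, inner ℝ (F x) (N x)) ∧
      -- directional identity, `|Du + F|`-almost everywhere, for every minimizer
      ∀ u : H10 Ω, IsMinimizer Ω φ F H u →
        ∀ᵐ x ∂((volume.restrict Ω).withDensity (fun x => ‖grad Ω u x + F x‖ₑ)),
          φ x (‖grad Ω u x + F x‖⁻¹ • (grad Ω u x + F x))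
            = inner ℝ (N x) (‖grad Ω u x + F x‖⁻¹ • (grad Ω u x + F x)) := by
  obtain ⟨α, hα, hφ⟩ := hC1
  have : IsFiniteMeasure (volume.restrict Ω) := ⟨by
    rw [Measure.restrict_apply_univ]
    exact hΩb.measure_lt_top⟩
  have h : IsNormIntegrand (volume.restrict Ω) φ α :=
    ⟨hφm, ae_restrict_of_forall_mem hΩo.measurableSet hφ,
      ae_restrict_of_forall_mem hΩo.measurableSet hC2⟩
  obtain ⟨N, hN, hNΦ, hglb⟩ := h.exists_mem_D0_isGLB hα.le hP
  have hle := h.ae_inner_le N hNΦ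
  have hinf := iInf_coe_eq_of_isGLB hglb
  have hweak : ∀ b, dual Ω φ F H b ≤ ((inner ℝ N F : ℝ) : EReal) := fun b => by
    rw [← hinf]
    refine le_iInf fun u => ?_
    rw [h.primal_eq]
    exact dual_le_coe b u
  have hstrong : ((inner ℝ N F : ℝ) : EReal) ≤ dual Ω φ F H N :=
    coe_le_dual hN fun v => by
      rw [funE_eq_integral]
      exact hNΦ _
  refine ⟨?_, N, fun b => (hweak b).trans hstrong, hN, hasWeakDivergence_of_mem_D0 hN, ?_, ?_, ?_⟩
  · rw [hinf]
    exact le_antisymm (hstrong.trans (le_iSup _ N)) (iSup_le hweak)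
  · filter_upwards [hle] with x hx using dualNorm_le_one hx
  · rwa [real_inner_comm, L2.inner_def] at hglb
  · intro u hu
    have hval : primal Ω φ F H u = inner ℝ N F :=
      le_antisymm (hglb.2 (by rintro _ ⟨v, rfl⟩; exact hu v)) (hglb.1 ⟨u, rfl⟩)
    refine (withDensity_absolutelyContinuous _ _).ae_le ?_
    filter_upwards [h.ae_eq_inner hN hle hval, h.isNorm] with x hx hn
    rw [hn.smul_eq, hx, real_inner_smul_right, abs_of_nonneg (inv_nonneg.2 (norm_nonneg _))]
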